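/- A function $q:\mathbb R^n\to(-\infty,\infty]$ is called a generalized quadratic form if there are a symmetric matrix $A\in\mathbb R^{n\times n}$ and a linear subspace $L\subset\mathbb R^n$ with $q(x)=\tfrac12\langle x,Ax\rangle$ for $x\in L$ and $q(x)=\infty$ for $x\notin L$. A sequence of functions $f_k:\mathbb R^n\to[-\infty,\infty]$ epi-converges to $f:\mathbb R^n\to[-\infty,\infty]$ if the outer limit (the set of limits of convergent sequences of points taken from a subsequence of the sets) and the inner limit (the set of limits of convergent sequences of points taken from all sets with sufficiently large index) of the epigraphs $\operatorname{epi} f_k=\{(x,\alpha)\in\mathbb R^n\times\mathbb R: \alpha\ge f_k(x)\}$ both equal $\operatorname{epi} f$. Let $\{q_k\}_{k\in\mathbb N}$ be a sequence of generalized quadratic forms on $\mathbb R^n$. Then: (i) There is a subsequence of $\{q_k\}$ that epi-converges to some function $q:\mathbb R^n\to[-\infty,\infty]$ with $q\not\equiv\infty$. (ii) Assume that $\{q_k\}$ epi-converges to a function $q:\mathbb R^n\to[-\infty,\infty]$ and that there is a number $r\ge 0$ such that $q_k(w)\ge -r\|w\|^2$ for all $w\in\mathbb R^n$ and all sufficiently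 large $k$. Then $q$ is a generalized quadratic form, and $q(w)\ge -r\|w\|^2$ for all $w\in\mathbb R^n$. -/

import Mathlib

open Filter Topology

namespace EpiQuad

/-- The quadratic function `q_A(x) = ⟨x, A x⟩` on `ℝⁿ`. -/
noncomputable def quadFun {n : ℕ} (A : Matrix (Fin n) (Fin n) ℝ)
    (x : EuclideanSpace ℝ (Fin n)) : ℝ :=
  inner ℝ x (Matrix.toEuclideanLin A x)

open scoped Classical in
/-- The indicator function `δ_C`: it is `0` on `C` and `∞` outside `C`. -/
noncomputable def indicatorFun {E : Type*} (C : Set E) (x : E) : EReal :=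
  if x ∈ C then 0 else ⊤

/-- `q` is a generalized quadratic form: `q = (1/2) q_A + δ_L` for a symmetric matrix `A` and a
linear subspace `L` of `ℝⁿ`. (Such a `q` never takes the value `-∞`.) -/
def IsGenQuadForm {n : ℕ} (q : EuclideanSpace ℝ (Fin n) → EReal) : Prop :=
  ∃ (A : Matrix (Fin n) (Fin n) ℝ) (L : Submodule ℝ (EuclideanSpace ℝ (Fin n))),
    A.IsSymm ∧
      ∀ x, q x = (((1 / 2 : ℝ) * quadFun A x : ℝ) : EReal) +
        indicatorFun (L : Set (EuclideanSpace ℝ (Fin n))) x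

/-- The epigraph of an extended-real-valued function, a subset of `E × ℝ`. -/
def epigraph {E : Type*} (f : E → EReal) : Set (E × ℝ) :=
  {z | f z.1 ≤ (z.2 : EReal)}

/-- The outer limit of a sequence of sets: all limits of convergent sequences of points taken from
a subsequence of the sets. -/
def outerLimit {X : Type*} [TopologicalSpace X] (C : ℕ → Set X) : Set X :=
  {x | ∃ φ : ℕ → ℕ, StrictMono φ ∧
    ∃ y : ℕ → X, (∀ j, y j ∈ C (φ j)) ∧ Tendsto y atTop (𝓝 x)}

/-- The inner limit of a sequence of sets: all limits of convergent sequences of points taken from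
all the sets with sufficiently large index. -/
def innerLimit {X : Type*} [TopologicalSpace X] (C : ℕ → Set X) : Set X :=
  {x | ∃ y : ℕ → X, (∀ᶠ k in atTop, y k ∈ C k) ∧ Tendsto y atTop (𝓝 x)}

/-- Epigraphical convergence `f_k → f`: the lower and upper epigraphical limits, that is, the
functions whose epigraphs are the outer and the inner limit of the epigraphs of the `f_k`, both
equal `f`. -/
def EpiConverges {E : Type*} [TopologicalSpace E] (f : ℕ → E → EReal) (g : E → EReal) : Prop :=
  outerLimit (fun k => epigraph (f k)) = epigraph g ∧
    innerLimit (fun k => epigraph (f k)) = epigraph g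

end EpiQuad

/-! For (i), each set in a sequence either meets or misses each member of a countable basis.
Compactness of the space of 0-1 patterns gives a subsequence along which the outer and inner limits
agree (`exists_subseq_outerLimit_eq_innerLimit`). The limit of epigraphs is closed and upward
closed, hence an epigraph, and it contains `(0, 0)`. For (ii), generalized quadratic forms are
recognized by inequalities on epigraphs: degree-two scaling, the parallelogram law and a quadratic
lower bound (`isGenQuadForm_of_parallelogram`, by a Jordan–von Neumann argument). These survive
epi-limits. For the parallelogram law, the lower bound keeps the values at `x ± y` in a compact box
(`EpiConverges.exists_parallelogram_le`). -/

namespace EpiQuad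

/-! ### Sequential compactness of set convergence -/

section SetLimits

variable {X : Type*} [TopologicalSpace X]

lemma mem_outerLimit_of_eventually {C : ℕ → Set X} {x : X} {φ : ℕ → ℕ} (hφ : StrictMono φ)
    {y : ℕ → X} (hy : ∀ᶠ j in atTop, y j ∈ C (φ j)) (hyx : Tendsto y atTop (𝓝 x)) :
    x ∈ outerLimit C := by
  obtain ⟨N, hN⟩ := eventually_atTop.1 hy
  exact ⟨fun j => φ (j + N), hφ.comp fun a b h => Nat.add_lt_add_right h N, fun j => y (j + N),
    fun j => hN _ (Nat.le_add_left N j), hyx.comp (tendsto_add_atTop_nat N)⟩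

lemma innerLimit_subset_outerLimit (C : ℕ → Set X) : innerLimit C ⊆ outerLimit C := by
  rintro x ⟨y, hy, hyx⟩
  exact mem_outerLimit_of_eventually strictMono_id hy hyx

lemma mem_innerLimit_of_forall_nhds [FirstCountableTopology X] {C : ℕ → Set X} {x : X}
    (h : ∀ U ∈ 𝓝 x, ∀ᶠ k in atTop, (C k ∩ U).Nonempty) : x ∈ innerLimit C := by
  classical
  obtain ⟨V, hV⟩ := (𝓝 x).exists_antitone_basis
  -- The point `z` is taken in the smallest `V m` with `m ≤ k` that `C k` meets. The cap `m ≤ k`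
  -- ensures that a largest such `m` exists.
  have hz : ∀ k, ∃ z, ∀ m ≤ k, (C k ∩ V m).Nonempty →
      (∀ i ≤ k, (C k ∩ V i).Nonempty → i ≤ m) → z ∈ C k ∩ V m := by
    intro k
    by_cases hne : ∃ m ≤ k, (C k ∩ V m).Nonempty ∧ ∀ i ≤ k, (C k ∩ V i).Nonempty → i ≤ m
    · obtain ⟨m, hm, ⟨z, hz⟩, hmax⟩ := hne
      refine ⟨z, fun m' hm' hne' hmax' => ?_⟩
      rwa [le_antisymm (hmax m' hm' hne') (hmax' m hm ⟨z, hz⟩)]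
    · exact ⟨x, fun m hm h1 h2 => (hne ⟨m, hm, h1, h2⟩).elim⟩
  choose z hz using hz
  have key : ∀ i, ∀ᶠ k in atTop, z k ∈ C k ∩ V i := by
    intro i
    filter_upwards [h _ (hV.1.mem_of_mem trivial : V i ∈ 𝓝 x), eventually_ge_atTop i] with k hk hik
    obtain ⟨m, hm, hmax⟩ := ((Finset.range (k + 1)).filter
      fun i => (C k ∩ V i).Nonempty).exists_max_image id ⟨i, by simp; exact ⟨by lia, hk⟩⟩
    simp only [Finset.mem_filter, Finset.mem_range, Nat.lt_succ_iff, id, and_imp] at hm hmax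
    have := hz k m hm.1 hm.2 hmax
    exact ⟨this.1, hV.2 (hmax i hik hk) this.2⟩
  refine ⟨z, (key 0).mono fun k hk => hk.1, hV.1.tendsto_right_iff.2 fun i _ => ?_⟩
  exact (key i).mono fun k hk => hk.2

lemma eventually_nonempty_inter_of_mem_innerLimit {C : ℕ → Set X} {x : X}
    (hx : x ∈ innerLimit C) {U : Set X} (hU : U ∈ 𝓝 x) :
    ∀ᶠ k in atTop, (C k ∩ U).Nonempty := by
  obtain ⟨y, hy, hyx⟩ := hx
  filter_upwards [hy, hyx hU] with k h1 h2 using ⟨y k, h1, h2⟩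

lemma isClosed_innerLimit [FirstCountableTopology X] (C : ℕ → Set X) :
    IsClosed (innerLimit C) := by
  refine isClosed_of_closure_subset fun x hx => mem_innerLimit_of_forall_nhds fun U hU => ?_
  obtain ⟨V, hVU, hV, hxV⟩ := mem_nhds_iff.1 hU
  obtain ⟨y, hyV, hy⟩ := mem_closure_iff.1 hx V hV hxV
  exact (eventually_nonempty_inter_of_mem_innerLimit hy (hV.mem_nhds hyV)).mono
    fun k hk => hk.mono (Set.inter_subset_inter_right _ hVU)

/-- Every sequence of subsets of a second countable space has a subsequence whose outer and inner
limits agree. -/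
lemma exists_subseq_outerLimit_eq_innerLimit [SecondCountableTopology X] (C : ℕ → Set X) :
    ∃ φ : ℕ → ℕ, StrictMono φ ∧
      outerLimit (fun k => C (φ k)) = innerLimit (fun k => C (φ k)) := by
  classical
  have := (TopologicalSpace.countable_countableBasis X).to_subtype
  obtain ⟨c, φ, hφ, hc⟩ := CompactSpace.tendsto_subseq
    (fun (k : ℕ) (U : TopologicalSpace.countableBasis X) => decide (C k ∩ U.1).Nonempty)
  refine ⟨φ, hφ, (innerLimit_subset_outerLimit _).antisymm' ?_⟩
  rintro x ⟨ψ, hψ, y, hy, hyx⟩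
  refine mem_innerLimit_of_forall_nhds fun U hU => ?_
  obtain ⟨V, hV, hxV, hVU⟩ := (TopologicalSpace.isBasis_countableBasis X).mem_nhds_iff.1 hU
  have hcV : ∀ᶠ k in atTop, decide (C (φ k) ∩ V).Nonempty = c ⟨V, hV⟩ := by
    have := (tendsto_pi_nhds.1 hc) ⟨V, hV⟩
    rw [nhds_discrete, tendsto_pure] at this
    exact this
  have hVx : V ∈ 𝓝 x := (TopologicalSpace.isOpen_of_mem_countableBasis hV).mem_nhds hxV
  obtain ⟨j, hj1, hj2⟩ := ((hψ.tendsto_atTop.eventually hcV).and (hyx hVx)).exists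
  have hctrue : c ⟨V, hV⟩ = true := by
    rw [← hj1]
    exact decide_eq_true ⟨y j, hy j, hj2⟩
  filter_upwards [hcV] with k hk
  rw [hctrue] at hk
  exact (of_decide_eq_true hk).mono (Set.inter_subset_inter_right _ hVU)

end SetLimits

/-- A closed set that is upward closed in the last coordinate is an epigraph. -/
lemma exists_epigraph_eq {E : Type*} [TopologicalSpace E] {S : Set (E × ℝ)} (hS : IsClosed S)
    (hup : ∀ x a b, (x, a) ∈ S → a ≤ b → (x, b) ∈ S) : ∃ p : E → EReal, epigraph p = S := by
  refine ⟨fun x => ⨅ a : {a : ℝ // (x, a) ∈ S}, ((a : ℝ) : EReal), ?_⟩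
  ext ⟨x, b⟩
  refine ⟨fun h => ?_, fun h => ?_⟩
  swap
  · exact iInf_le (fun a : {a : ℝ // (x, a) ∈ S} => ((a : ℝ) : EReal)) ⟨b, h⟩
  -- The infimum only gives heights `c > b`; closedness of `S` then reaches `b`.
  have hb : ∀ c, b < c → (x, c) ∈ S := by
    intro c hc
    obtain ⟨⟨a, ha⟩, hac⟩ := iInf_lt_iff.1 (lt_of_le_of_lt h (EReal.coe_lt_coe_iff.2 hc))
    exact hup x a c ha (EReal.coe_lt_coe_iff.1 hac).le
  have hlim : Tendsto (fun c : ℝ => (x, c)) (𝓝[>] b) (𝓝 (x, b)) :=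
    ((Continuous.prodMk_right x).tendsto b).mono_left nhdsWithin_le_nhds
  exact hS.mem_of_tendsto hlim (eventually_mem_nhdsWithin.mono hb)

lemma exists_subseq_epiConverges {E : Type*} [TopologicalSpace E] [SecondCountableTopology E]
    (f : ℕ → E → EReal) :
    ∃ φ : ℕ → ℕ, StrictMono φ ∧ ∃ p, EpiConverges (fun k => f (φ k)) p := by
  obtain ⟨φ, hφ, h⟩ := exists_subseq_outerLimit_eq_innerLimit fun k => epigraph (f k)
  obtain ⟨p, hp⟩ := exists_epigraph_eq (isClosed_innerLimit fun k => epigraph (f (φ k))) (by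
    rintro x a b ⟨y, hy, hyx⟩ hab
    refine ⟨fun k => ((y k).1, (y k).2 + (b - a)), hy.mono fun k hk => ?_, ?_⟩
    · exact le_trans (show f (φ k) (y k).1 ≤ _ from hk)
        (EReal.coe_le_coe_iff.2 (by linarith))
    · have h1 := (continuous_fst.tendsto _).comp hyx
      have h2 := ((continuous_snd.tendsto _).comp hyx).add_const (b - a)
      simpa using h1.prodMk_nhds h2)
  exact ⟨φ, hφ, p, h.trans hp.symm, hp.symm⟩

/-! ### Functions satisfying the parallelogram law -/

section Parallelogram

variable {E : Type*} [NormedAddCommGroup E] [NormedSpace ℝ E]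

/-- A real function that satisfies the parallelogram law and is homogeneous of degree two, and is
bounded below by a multiple of the squared norm, has a bilinear polar form. -/
lemma exists_bilin_of_parallelogram {P : E → ℝ} {r : ℝ}
    (hpar : ∀ x y, P (x + y) + P (x - y) = 2 * P x + 2 * P y)
    (hsmul : ∀ (t : ℝ) x, P (t • x) = t ^ 2 * P x) (hlow : ∀ x, -r * ‖x‖ ^ 2 ≤ P x) :
    ∃ B : E →ₗ[ℝ] E →ₗ[ℝ] ℝ, ∀ x y, B x y = P (x + y) - P x - P y := by
  have hadd : ∀ x y z, P (x + y + z) - P (x + y) - P z =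
      (P (x + z) - P x - P z) + (P (y + z) - P y - P z) := by
    intro x y z
    -- In `h1 + h2 - h3` the values at `z ± (x - y)` cancel, and `h4` eliminates `P (x - y)`.
    have h1 := hpar (x + z) y
    have h2 := hpar (y + z) x
    have h3 := hpar z (x - y)
    have h4 := hpar x y
    rw [show x + z + y = x + y + z by abel, show x + z - y = z + (x - y) by abel] at h1
    rw [show y + z + x = x + y + z by abel, show y + z - x = z - (x - y) by abel] at h2
    linarith
  have hcomm : ∀ x y, P (x + y) - P x - P y = P (y + x) - P y - P x := by
    intro x y
    rw [add_comm x y]; ring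
  have hsm : ∀ (t : ℝ) x y, P (t • x + y) - P (t • x) - P y = t * (P (x + y) - P x - P y) := by
    intro t x y
    -- An additive real function bounded near `0` is continuous, hence linear.
    let g : ℝ →+ ℝ := AddMonoidHom.mk' (fun t => P (t • x + y) - P (t • x) - P y) fun s t => by
      simp only [add_smul]
      exact hadd _ _ _
    have hg : Continuous g := by
      refine g.continuous_of_isBounded_nhds_zero (Metric.closedBall_mem_nhds 0 one_pos) ?_
      refine isBounded_iff_forall_norm_le.2
        ⟨|r| * (‖x‖ + ‖y‖) ^ 2 + |P x| + |P y|, ?_⟩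
      rintro _ ⟨t, ht, rfl⟩
      have ht : |t| ≤ 1 := by simpa using ht
      have hn : ‖t • x‖ ≤ ‖x‖ := by
        rw [norm_smul]
        exact mul_le_of_le_one_left (norm_nonneg _) ht
      have hb : ∀ v : E, ‖v‖ ≤ ‖x‖ + ‖y‖ → -(|r| * (‖x‖ + ‖y‖) ^ 2) ≤ P v := by
        intro v hv
        have h1 : ‖v‖ ^ 2 ≤ (‖x‖ + ‖y‖) ^ 2 := pow_le_pow_left₀ (norm_nonneg _) hv 2
        have h2 : r * ‖v‖ ^ 2 ≤ |r| * (‖x‖ + ‖y‖) ^ 2 :=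
          mul_le_mul (le_abs_self r) h1 (sq_nonneg _) (abs_nonneg r)
        linarith [hlow v]
      have h1 := hb (t • x + y) ((norm_add_le _ _).trans (by linarith))
      have h2 := hb (t • x - y) ((norm_sub_le _ _).trans (by linarith))
      -- The law turns the lower bound at `t • x - y` into an upper bound at `t • x + y`.
      have h3 := hpar (t • x) y
      have h4 : |P (t • x)| ≤ |P x| := by
        rw [hsmul, abs_mul, abs_pow]
        exact mul_le_of_le_one_left (abs_nonneg _) (pow_le_one₀ (abs_nonneg _) ht)
      have h5 := abs_le.1 h4
      have h6 := neg_abs_le (P y)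
      have h7 := le_abs_self (P y)
      change |P (t • x + y) - P (t • x) - P y| ≤ _
      rw [abs_le]
      constructor <;> linarith [h5.1, h5.2]
    have := map_real_smul g hg t 1
    simpa [g] using this
  refine ⟨LinearMap.mk₂ ℝ (fun x y => P (x + y) - P x - P y) hadd hsm ?_ ?_, fun x y => rfl⟩
  · intro x y z
    rw [hcomm x, hcomm x y, hcomm x z]
    exact hadd y z x
  · intro t x y
    rw [hcomm x, hcomm x y]
    exact hsm t y x

/-- One-sided versions of the parallelogram law and of homogeneity suffice. -/
lemma exists_bilin_of_parallelogram_le {P : E → ℝ} {r : ℝ}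
    (hpar : ∀ x y, P (x + y) + P (x - y) ≤ 2 * P x + 2 * P y)
    (hsmul : ∀ (t : ℝ) x, P (t • x) ≤ t ^ 2 * P x) (hlow : ∀ x, -r * ‖x‖ ^ 2 ≤ P x) :
    ∃ B : E →ₗ[ℝ] E →ₗ[ℝ] ℝ, (∀ x y, B x y = B y x) ∧ ∀ x, P x = 1 / 2 * B x x := by
  have hsmul' : ∀ (t : ℝ) x, P (t • x) = t ^ 2 * P x := by
    intro t x
    refine (hsmul t x).antisymm ?_
    rcases eq_or_ne t 0 with rfl | ht
    · simpa using hlow 0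
    · have h := mul_le_mul_of_nonneg_left (hsmul t⁻¹ (t • x)) (sq_nonneg t)
      rwa [inv_smul_smul₀ ht, ← mul_assoc, ← mul_pow, mul_inv_cancel₀ ht, one_pow, one_mul] at h
  have hpar' : ∀ x y, P (x + y) + P (x - y) = 2 * P x + 2 * P y := by
    intro x y
    refine (hpar x y).antisymm ?_
    -- The inequality at `(x + y, x - y)`, rescaled, is the reverse inequality at `(x, y)`.
    have h := hpar (x + y) (x - y)
    rw [show x + y + (x - y) = (2 : ℝ) • x by rw [two_smul]; abel,
      show x + y - (x - y) = (2 : ℝ) • y by rw [two_smul]; abel, hsmul', hsmul'] at h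
    linarith
  obtain ⟨B, hB⟩ := exists_bilin_of_parallelogram hpar' hsmul' hlow
  refine ⟨B, fun x y => ?_, fun x => ?_⟩
  · rw [hB, hB, add_comm]; ring
  · rw [hB, ← two_smul ℝ x, hsmul']; ring

end Parallelogram

/-! ### Generalized quadratic forms -/

variable {n : ℕ}

lemma exists_matrix_of_bilin
    (B : EuclideanSpace ℝ (Fin n) →ₗ[ℝ] EuclideanSpace ℝ (Fin n) →ₗ[ℝ] ℝ)
    (hB : ∀ x y, B x y = B y x) :
    ∃ A : Matrix (Fin n) (Fin n) ℝ, A.IsSymm ∧ ∀ x, quadFun A x = B x x := by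
  let b := (EuclideanSpace.basisFun (Fin n) ℝ).toBasis
  refine ⟨Matrix.of fun i j => B (b i) (b j), Matrix.IsSymm.ext fun i j => hB _ _, fun x => ?_⟩
  rw [← LinearMap.sum_repr_mul_repr_mul b b x x, Finsupp.sum_fintype _ _ (by simp)]
  simp only [quadFun, PiLp.inner_apply, Matrix.ofLp_toLpLin, Matrix.toLin'_apply, Matrix.mulVec,
    dotProduct, Matrix.of_apply]
  refine Finset.sum_congr rfl fun i _ => ?_
  rw [Finsupp.sum_fintype _ _ (by simp)]
  simp only [b, OrthonormalBasis.coe_toBasis_repr_apply, EuclideanSpace.basisFun_repr, smul_eq_mul,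
    RCLike.inner_apply, conj_trivial, Finset.sum_mul]
  exact Finset.sum_congr rfl fun j _ => by ring

lemma quadFun_smul (A : Matrix (Fin n) (Fin n) ℝ) (t : ℝ) (x : EuclideanSpace ℝ (Fin n)) :
    quadFun A (t • x) = t ^ 2 * quadFun A x := by
  simp only [quadFun, map_smul, inner_smul_left, inner_smul_right, conj_trivial]
  ring

lemma quadFun_parallelogram (A : Matrix (Fin n) (Fin n) ℝ) (x y : EuclideanSpace ℝ (Fin n)) :
    quadFun A (x + y) + quadFun A (x - y) = 2 * quadFun A x + 2 * quadFun A y := by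
  simp only [quadFun, map_add, map_sub, inner_add_left, inner_add_right, inner_sub_left,
    inner_sub_right]
  ring

lemma IsGenQuadForm.exists_le_coe_iff {q : EuclideanSpace ℝ (Fin n) → EReal}
    (hq : IsGenQuadForm q) :
    ∃ (A : Matrix (Fin n) (Fin n) ℝ) (L : Submodule ℝ (EuclideanSpace ℝ (Fin n))),
      ∀ x (a : ℝ), q x ≤ a ↔ x ∈ L ∧ 1 / 2 * quadFun A x ≤ a := by
  obtain ⟨A, L, -, h⟩ := hq
  refine ⟨A, L, fun x a => ?_⟩
  rw [h x, indicatorFun]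
  by_cases hx : x ∈ L
  · simp only [SetLike.mem_coe, hx, if_true, add_zero, EReal.coe_le_coe_iff, true_and]
  · simp only [SetLike.mem_coe, hx, if_false, false_and, iff_false, EReal.coe_add_top]
    exact not_le_of_gt (EReal.coe_lt_top a)

lemma IsGenQuadForm.zero_le_coe {q : EuclideanSpace ℝ (Fin n) → EReal} (hq : IsGenQuadForm q) :
    q 0 ≤ (0 : ℝ) := by
  obtain ⟨A, L, h⟩ := hq.exists_le_coe_iff
  exact (h 0 0).2 ⟨L.zero_mem, by simp [quadFun]⟩

lemma IsGenQuadForm.smul_le {q : EuclideanSpace ℝ (Fin n) → EReal} (hq : IsGenQuadForm q) (t : ℝ)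
    {x : EuclideanSpace ℝ (Fin n)} {a : ℝ} (hx : q x ≤ a) : q (t • x) ≤ (t ^ 2 * a : ℝ) := by
  obtain ⟨A, L, h⟩ := hq.exists_le_coe_iff
  rw [h] at hx ⊢
  refine ⟨L.smul_mem t hx.1, ?_⟩
  rw [quadFun_smul]
  linarith [mul_le_mul_of_nonneg_left hx.2 (sq_nonneg t)]

/-- Real upper bounds replace extended-real sums, so the law speaks of epigraph points only and can
pass to limits. -/
lemma IsGenQuadForm.exists_parallelogram_le {q : EuclideanSpace ℝ (Fin n) → EReal}
    (hq : IsGenQuadForm q) {x y : EuclideanSpace ℝ (Fin n)} {a b : ℝ} (hx : q x ≤ a)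
    (hy : q y ≤ b) :
    ∃ c : ℝ × ℝ, q (x + y) ≤ c.1 ∧ q (x - y) ≤ c.2 ∧ c.1 + c.2 ≤ 2 * a + 2 * b := by
  obtain ⟨A, L, h⟩ := hq.exists_le_coe_iff
  rw [h] at hx hy
  refine ⟨(1 / 2 * quadFun A (x + y), 1 / 2 * quadFun A (x - y)),
    (h _ _).2 ⟨L.add_mem hx.1 hy.1, le_rfl⟩, (h _ _).2 ⟨L.sub_mem hx.1 hy.1, le_rfl⟩, ?_⟩
  linarith [quadFun_parallelogram A x y, hx.2, hy.2]

/-- Recognition of generalized quadratic forms through their epigraphs. -/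
lemma isGenQuadForm_of_parallelogram {p : EuclideanSpace ℝ (Fin n) → EReal} {r : ℝ} (hr : 0 ≤ r)
    (hlow : ∀ w, ((-r * ‖w‖ ^ 2 : ℝ) : EReal) ≤ p w) (hzero : p 0 ≤ (0 : ℝ))
    (hsmul : ∀ (t : ℝ) x (a : ℝ), p x ≤ a → p (t • x) ≤ (t ^ 2 * a : ℝ))
    (hpar : ∀ x y (a b : ℝ), p x ≤ a → p y ≤ b →
      ∃ c : ℝ × ℝ, p (x + y) ≤ c.1 ∧ p (x - y) ≤ c.2 ∧ c.1 + c.2 ≤ 2 * a + 2 * b) :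
    IsGenQuadForm p := by
  let L : Submodule ℝ (EuclideanSpace ℝ (Fin n)) :=
    { carrier := {x | ∃ a : ℝ, p x ≤ a}
      zero_mem' := ⟨0, hzero⟩
      add_mem' := by
        rintro x y ⟨a, ha⟩ ⟨b, hb⟩
        obtain ⟨c, hc, -⟩ := hpar x y a b ha hb
        exact ⟨c.1, hc⟩
      smul_mem' := by
        rintro t x ⟨a, ha⟩
        exact ⟨_, hsmul t x a ha⟩ }
  have hcoe : ∀ x ∈ L, ((p x).toReal : EReal) = p x := by
    rintro x ⟨a, ha⟩
    refine EReal.coe_toReal (ne_top_of_le_ne_top (EReal.coe_ne_top a) ha) fun h => ?_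
    exact (EReal.bot_lt_coe _).not_ge (h ▸ hlow x)
  -- Composing with the orthogonal projection onto `L` extends the finite values to the whole space.
  -- The lower bound persists because the projection does not increase norms and `r ≥ 0`.
  let P : EuclideanSpace ℝ (Fin n) → ℝ := fun x => (p (L.starProjection x)).toReal
  have hP : ∀ x, (P x : EReal) = p (L.starProjection x) := fun x =>
    hcoe _ (L.starProjection_apply_mem x)
  have hPle : ∀ x (a : ℝ), p (L.starProjection x) ≤ a → P x ≤ a := fun x a h => by
    rwa [← hP, EReal.coe_le_coe_iff] at h
  obtain ⟨B, hsymm, hB⟩ := exists_bilin_of_parallelogram_le (P := P) (r := r) (by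
      intro x y
      obtain ⟨c, h1, h2, h3⟩ := hpar _ _ _ _ (hP x).ge (hP y).ge
      rw [← map_add] at h1
      rw [← map_sub] at h2
      linarith [hPle _ _ h1, hPle _ _ h2]) (by
      intro t x
      refine hPle _ _ ?_
      rw [map_smul]
      exact hsmul t _ _ (hP x).ge) (by
      intro x
      have h1 := hlow (L.starProjection x)
      rw [← hP, EReal.coe_le_coe_iff] at h1
      have h2 := pow_le_pow_left₀ (norm_nonneg _) (L.norm_starProjection_apply_le x) 2
      linarith [mul_le_mul_of_nonneg_left h2 hr])
  obtain ⟨A, hA, hAB⟩ := exists_matrix_of_bilin B hsymm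
  refine ⟨A, L, hA, fun x => ?_⟩
  rw [hAB, ← hB, indicatorFun]
  by_cases hx : x ∈ L
  · rw [if_pos (SetLike.mem_coe.2 hx), add_zero, hP, L.starProjection_eq_self_iff.2 hx]
  · rw [if_neg (fun h => hx (SetLike.mem_coe.1 h)), EReal.coe_add_top]
    by_contra hne
    exact hx ⟨_, EReal.le_coe_toReal hne⟩

/-! ### Epigraphical limits of generalized quadratic forms -/

lemma EpiConverges.exists_recovery {E : Type*} [TopologicalSpace E] {f : ℕ → E → EReal}
    {p : E → EReal} (h : EpiConverges f p) {x : E} {a : ℝ} (hx : p x ≤ a) :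
    ∃ (u : ℕ → E) (c : ℕ → ℝ), (∀ᶠ k in atTop, f k (u k) ≤ c k) ∧ Tendsto u atTop (𝓝 x) ∧
      Tendsto c atTop (𝓝 a) := by
  obtain ⟨y, hy, hyx⟩ : (x, a) ∈ innerLimit fun k => epigraph (f k) := by
    rw [h.2]; exact hx
  exact ⟨fun k => (y k).1, fun k => (y k).2, hy, (continuous_fst.tendsto _).comp hyx,
    (continuous_snd.tendsto _).comp hyx⟩

/-- This uses the outer limit, so bounds along a subsequence suffice; `exists_recovery` uses the
inner limit. -/
lemma EpiConverges.le_of_tendsto {E : Type*} [TopologicalSpace E] {f : ℕ → E → EReal}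
    {p : E → EReal} (h : EpiConverges f p) {x : E} {a : ℝ} {φ : ℕ → ℕ} (hφ : StrictMono φ)
    {u : ℕ → E} {c : ℕ → ℝ} (hu : Tendsto u atTop (𝓝 x)) (hc : Tendsto c atTop (𝓝 a))
    (hle : ∀ᶠ j in atTop, f (φ j) (u j) ≤ c j) : p x ≤ a := by
  have : (x, a) ∈ epigraph p := by
    rw [← h.1]
    exact mem_outerLimit_of_eventually hφ (y := fun j => (u j, c j)) hle (hu.prodMk_nhds hc)
  exact this

lemma EpiConverges.le_of_eventually_le {E : Type*} [TopologicalSpace E] {f : ℕ → E → EReal}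
    {p : E → EReal} (h : EpiConverges f p) {g : E → ℝ} (hg : Continuous g)
    (hle : ∀ᶠ k in atTop, ∀ w, (g w : EReal) ≤ f k w) (w : E) : (g w : EReal) ≤ p w := by
  refine EReal.le_of_forall_lt_iff_le.1 fun a ha => ?_
  obtain ⟨u, c, huc, hu, hc⟩ := h.exists_recovery ha.le
  refine EReal.coe_le_coe_iff.2 (le_of_tendsto_of_tendsto ((hg.tendsto w).comp hu) hc ?_)
  filter_upwards [huc, hle] with k h1 h2
  exact EReal.coe_le_coe_iff.1 ((h2 _).trans h1)

lemma EpiConverges.exists_parallelogram_le {q : ℕ → EuclideanSpace ℝ (Fin n) → EReal}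
    (hq : ∀ k, IsGenQuadForm (q k)) {p : EuclideanSpace ℝ (Fin n) → EReal}
    (h : EpiConverges q p) {r : ℝ}
    (hlow : ∀ᶠ k in atTop, ∀ w, ((-r * ‖w‖ ^ 2 : ℝ) : EReal) ≤ q k w)
    {x y : EuclideanSpace ℝ (Fin n)} {a b : ℝ} (hx : p x ≤ a) (hy : p y ≤ b) :
    ∃ c : ℝ × ℝ, p (x + y) ≤ c.1 ∧ p (x - y) ≤ c.2 ∧ c.1 + c.2 ≤ 2 * a + 2 * b := by
  obtain ⟨u, α, huα, hu, hα⟩ := h.exists_recovery hx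
  obtain ⟨v, β, hvβ, hv, hβ⟩ := h.exists_recovery hy
  obtain ⟨c, hc⟩ := ((huα.and hvβ).mono fun k hk =>
    (hq k).exists_parallelogram_le hk.1 hk.2).choice
  have hg : Continuous fun w : EuclideanSpace ℝ (Fin n) => -r * ‖w‖ ^ 2 := by fun_prop
  have h1 := (hg.tendsto _).comp (hu.add hv)
  have h2 := (hg.tendsto _).comp (hu.sub hv)
  have h3 := (hα.const_mul 2).add (hβ.const_mul 2)
  -- Eventually `s` and `t` bound the two coordinates of `c k` from below and `M` bounds their sum
  -- from above; the slack `1` absorbs the convergence errors.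
  set s := -r * ‖x + y‖ ^ 2 - 1 with hs
  set t := -r * ‖x - y‖ ^ 2 - 1 with ht
  set M := 2 * a + 2 * b + 1 with hM
  have hmem : ∀ᶠ k in atTop, c k ∈ Set.Icc (s, t) (M - t, M - s) := by
    filter_upwards [hc, hlow, h1.eventually (lt_mem_nhds (sub_one_lt _)),
      h2.eventually (lt_mem_nhds (sub_one_lt _)),
      h3.eventually (gt_mem_nhds (lt_add_one _))] with k hk hk' k1 k2 k3
    have e1 := EReal.coe_le_coe_iff.1 ((hk' _).trans hk.1)
    have e2 := EReal.coe_le_coe_iff.1 ((hk' _).trans hk.2.1)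
    have e3 := hk.2.2
    simp only [Function.comp_apply] at k1 k2
    refine ⟨⟨?_, ?_⟩, ⟨?_, ?_⟩⟩ <;> dsimp only <;> linarith
  obtain ⟨d, -, φ, hφ, hd⟩ := isCompact_Icc.tendsto_subseq' hmem.frequently
  have hd1 := (continuous_fst.tendsto _).comp hd
  have hd2 := (continuous_snd.tendsto _).comp hd
  have hφt := hφ.tendsto_atTop
  have hcφ := hφt.eventually hc
  exact ⟨d, h.le_of_tendsto hφ ((hu.add hv).comp hφt) hd1 (hcφ.mono fun k hk => hk.1),
    h.le_of_tendsto hφ ((hu.sub hv).comp hφt) hd2 (hcφ.mono fun k hk => hk.2.1),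
    le_of_tendsto_of_tendsto (hd1.add hd2) (h3.comp hφt) (hcφ.mono fun k hk => hk.2.2)⟩

lemma EpiConverges.zero_le {q : ℕ → EuclideanSpace ℝ (Fin n) → EReal}
    (hq : ∀ k, IsGenQuadForm (q k)) {p : EuclideanSpace ℝ (Fin n) → EReal}
    (h : EpiConverges q p) : p 0 ≤ (0 : ℝ) :=
  h.le_of_tendsto strictMono_id tendsto_const_nhds tendsto_const_nhds
    (Eventually.of_forall fun k => (hq k).zero_le_coe)

lemma EpiConverges.smul_le {q : ℕ → EuclideanSpace ℝ (Fin n) → EReal}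
    (hq : ∀ k, IsGenQuadForm (q k)) {p : EuclideanSpace ℝ (Fin n) → EReal}
    (h : EpiConverges q p) (t : ℝ) {x : EuclideanSpace ℝ (Fin n)} {a : ℝ} (hx : p x ≤ a) :
    p (t • x) ≤ (t ^ 2 * a : ℝ) := by
  obtain ⟨u, α, huα, hu, hα⟩ := h.exists_recovery hx
  exact h.le_of_tendsto strictMono_id (hu.const_smul t) (hα.const_mul _)
    (huα.mono fun k hk => (hq k).smul_le t hk)

end EpiQuad

theorem mainTheorem9 (n : ℕ) (q : ℕ → EuclideanSpace ℝ (Fin n) → EReal)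
    (hq : ∀ k, EpiQuad.IsGenQuadForm (q k)) :
    (∃ φ : ℕ → ℕ, StrictMono φ ∧ ∃ p : EuclideanSpace ℝ (Fin n) → EReal,
      EpiQuad.EpiConverges (fun k => q (φ k)) p ∧ ∃ w, p w ≠ ⊤) ∧
    (∀ p : EuclideanSpace ℝ (Fin n) → EReal, EpiQuad.EpiConverges q p →
      ∀ r : ℝ, 0 ≤ r →
        (∀ᶠ k in atTop, ∀ w, ((-r * ‖w‖ ^ 2 : ℝ) : EReal) ≤ q k w) →
        EpiQuad.IsGenQuadForm p ∧ ∀ w, ((-r * ‖w‖ ^ 2 : ℝ) : EReal) ≤ p w) := by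
  refine ⟨?_, fun p hp r hr hlow => ?_⟩
  · obtain ⟨φ, hφ, p, hp⟩ := EpiQuad.exists_subseq_epiConverges q
    exact ⟨φ, hφ, p, hp, 0,
      ne_top_of_le_ne_top (EReal.coe_ne_top 0) (hp.zero_le fun k => hq (φ k))⟩
  · have hlow' := hp.le_of_eventually_le (g := fun w => -r * ‖w‖ ^ 2) (by fun_prop) hlow
    exact ⟨EpiQuad.isGenQuadForm_of_parallelogram hr hlow' (hp.zero_le hq)
      (fun t x a hx => hp.smul_le hq t hx)
      (fun x y a b hx hy => hp.exists_parallelogram_le hq hlow hx hy), hlow'⟩
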